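/- Let $\mathcal H(\mathbb C)$ be the space of entire functions with the topology of locally uniform convergence, and for $b\in\mathbb C$ let $T_b:\mathcal H(\mathbb C)\to\mathcal H(\mathbb C)$ be the translation operator $T_b f(z)=f(z+b)$. For a sequence $(S_n)_{n\ge 1}$ of continuous linear operators on $\mathcal H(\mathbb C)$ let $HC(\{S_n\})$ be the set of all $f\in\mathcal H(\mathbb C)$ for which $\{S_n f: n=1,2,\dots\}$ is dense in $\mathcal H(\mathbb C)$. Let $(\lambda_n)_{n\ge 1}$ be a sequence of non-zero complex numbers such that, as $n\to\infty$, (1) $|\lambda_{n+1}|-|\lambda_n|\to+\infty$; (2) $\lambda_{n+1}/\lambda_n\to 1$; (3) $\liminf_{n\to\infty} n\left(\left|\lambda_{n+1}/\lambda_n\right|-1\right)>0$ (the value $+\infty$ being allowed). Then $\bigcap_{a\in\mathbb C\setminus\{0\}}HC(\{T_{\lambda_n a}\})$ is a $G_\delta$ and dense subset of $\mathcal H(\mathbb C)$. -/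

import Mathlib

open Filter Topology

/-- The set `HC({T_n})` of hypercyclic vectors of a sequence `(T_n)`, `n = 1, 2, …`, of continuous
linear operators on a topological vector space: the vectors `x` whose orbit `{T_n x : n ≥ 1}` is
dense. -/
def HC {X : Type*} [AddCommMonoid X] [Module ℂ X] [TopologicalSpace X]
    (T : ℕ+ → X →L[ℂ] X) : Set X :=
  {x | Dense (Set.range fun n => T n x)}

/-- The space `H(ℂ)` of entire functions, as a subspace of `C(ℂ, ℂ)`. Its topology is the one induced
by the compact-open topology of `C(ℂ, ℂ)`, that is, the topology of local uniform convergence. -/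
def EntireFun : Submodule ℂ C(ℂ, ℂ) where
  carrier := {f | Differentiable ℂ (f : ℂ → ℂ)}
  add_mem' hf hg := Differentiable.add hf hg
  zero_mem' := differentiable_const (0 : ℂ)
  smul_mem' c _ hf := Differentiable.const_smul hf c

/-- The continuous map `z ↦ z + a` of the complex plane. -/
def shift (a : ℂ) : C(ℂ, ℂ) := ⟨fun z => z + a, by fun_prop⟩

/-- The translation operator `T_a` on `H(ℂ)`, `T_a f (z) = f (z + a)`. -/
noncomputable def translation (a : ℂ) : EntireFun →L[ℂ] EntireFun where
  toFun f := ⟨(f : C(ℂ, ℂ)).comp (shift a),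
    Differentiable.comp (g := ((f : C(ℂ, ℂ)) : ℂ → ℂ)) f.2
      (differentiable_id.add_const a : Differentiable ℂ fun z : ℂ => z + a)⟩
  map_add' _ _ := rfl
  map_smul' _ _ := rfl
  cont := ((ContinuousMap.continuous_precomp (shift a)).comp continuous_subtype_val).subtype_mk _

/-!
The set in question is a countable intersection of sets `hitSet lam K V`, with `K` running over compact
sets that exhaust the punctured plane and `V` over a countable base: `f` belongs to `hitSet lam K V`
if for each `a ∈ K` some translate `f (· + lam n * a)` lies in `V`. These sets are open, because `K` is
compact and translation is jointly continuous, so by Baire's theorem it is enough that each of them is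
dense. Finite intersections of dense open sets are dense, so `K` may be replaced by a small disc around
a point `a₀ ≠ 0`, of a size that is allowed to depend on `V`.

Density near `a₀` (`exists_entire_hitting`) comes down to an approximation problem with a geometric
input. If an entire `f` is close to `g (· - lam n * a')` on a disc of fixed radius around `lam n * a'`,
then `f (· + lam n * a)` is close to `g` for all `a` at distance at most `δ / ‖lam n‖` from `a'`. Let
`a'` run over a square lattice of mesh `δ / (2 L)` with `L` large, and split the lattice into `q ^ 2`
sublattices of mesh `q δ / (2 L)`. As `lam (n + 1) / lam n → 1` and `‖lam n‖ → ∞`, there are `q ^ 2`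
indices `n` with `L ≤ ‖lam n‖ ≤ 2 L` whose moduli grow by a factor of at least `1 + θ` from one to the
next (`exists_slow_subsequence`). Each index serves one sublattice. Within a sublattice the discs are
disjoint because `q δ / 2` exceeds their diameter; for different indices they lie in disjoint annuli
because the neighbourhood of `a₀` is small compared with `θ`.

The approximation of functions prescribed on these discs by entire functions needs no general Runge
theorem. The discs can be added in an order (along rows, then row by row, then annulus by annulus) in
which a line separates what is joined from what is already there (`Approximable.union`). For two
bounded sets separated by a line it suffices to have entire functions close to `0` on one set and to
`1` on the other. They are iterates of the polynomial `z + h z (1 - z ^ 2)`, suitably normalized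
(`exists_entire_step`): in the coordinate `u = (z - 1) / (z + 1)` of the right half plane, on any disc
`‖u‖ ≤ q < 1`, this map decreases `‖u‖` by a constant factor if `h` is small, so its iterates tend to
`1` there, and by oddness to `-1` on the reflected disc.
-/

/-! ### Polynomials close to a step function -/

/-- One Euler step, of length `h`, for the differential equation `z' = z (1 - z ^ 2)`. Its flow
carries the right half plane to `1` and the left half plane to `-1`. -/
noncomputable def eulerStep (h : ℝ) (z : ℂ) : ℂ := z + h * (z * (1 - z ^ 2))

lemma differentiable_eulerStep_iterate (h : ℝ) (n : ℕ) :
    Differentiable ℂ ((eulerStep h)^[n]) := by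
  have h1 : Differentiable ℂ (eulerStep h) := by
    unfold eulerStep
    fun_prop
  induction n with
  | zero => exact differentiable_id
  | succ n ih =>
    rw [Function.iterate_succ]
    exact ih.comp h1

lemma eulerStep_neg (h : ℝ) (z : ℂ) : eulerStep h (-z) = -eulerStep h z := by
  unfold eulerStep
  ring

lemma eulerStep_iterate_neg (h : ℝ) (n : ℕ) (z : ℂ) :
    (eulerStep h)^[n] (-z) = -(eulerStep h)^[n] z := by
  induction n generalizing z with
  | zero => rfl
  | succ n ih => rw [Function.iterate_succ_apply, Function.iterate_succ_apply, eulerStep_neg, ih]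

lemma norm_sub_one_sq (z : ℂ) : ‖z - 1‖ ^ 2 = ‖z‖ ^ 2 + 1 - 2 * z.re := by
  simp only [← Complex.normSq_eq_norm_sq, Complex.normSq_apply]
  simp
  ring

lemma norm_add_one_sq (z : ℂ) : ‖z + 1‖ ^ 2 = ‖z‖ ^ 2 + 1 + 2 * z.re := by
  simp only [← Complex.normSq_eq_norm_sq, Complex.normSq_apply]
  simp
  ring

/-- The disc `‖z - 1‖ ≤ q ‖z + 1‖` is bounded and stays away from the imaginary axis. -/
lemma bounds_of_norm_sub_one_le {q : ℝ} (hq0 : 0 < q) (hq1 : q < 1) {z : ℂ}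
    (hz : ‖z - 1‖ ≤ q * ‖z + 1‖) : ‖z‖ ≤ 2 / (1 - q) ∧ (1 - q ^ 2) / 4 ≤ z.re := by
  constructor
  · rw [le_div_iff₀ (by linarith)]
    have h1 : ‖z‖ - 1 ≤ ‖z - 1‖ := by simpa using norm_sub_norm_le z 1
    have h2 : ‖z + 1‖ ≤ ‖z‖ + 1 := by simpa using norm_add_le z 1
    nlinarith [norm_nonneg z]
  · have h1 : ‖z - 1‖ ^ 2 ≤ q ^ 2 * ‖z + 1‖ ^ 2 := by
      rw [← mul_pow]
      exact pow_le_pow_left₀ (norm_nonneg _) hz 2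
    rw [norm_sub_one_sq, norm_add_one_sq] at h1
    have hq2 : q ^ 2 < 1 := by nlinarith
    have h0 : 0 ≤ z.re := by nlinarith [sq_nonneg ‖z‖]
    nlinarith [sq_nonneg ‖z‖]

/-- The modulus of `(z - 1) / (z + 1)` is multiplied by at most `κ` in a step: that quotient gets
multiplied by `(1 - h z ^ 2 - h z) / (1 - h z ^ 2 + h z)`, and the squared moduli of denominator
and numerator differ by `4 h (1 - h ‖z‖ ^ 2) re z`. -/
lemma exists_eulerStep_contraction {q : ℝ} (hq0 : 0 < q) (hq1 : q < 1) :
    ∃ h κ : ℝ, 0 < κ ∧ κ < 1 ∧ ∀ z : ℂ, ‖z - 1‖ ≤ q * ‖z + 1‖ →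
      ‖eulerStep h z - 1‖ * ‖z + 1‖ ≤ κ * (‖eulerStep h z + 1‖ * ‖z - 1‖) := by
  set M : ℝ := 2 / (1 - q) with hM
  set d : ℝ := (1 - q ^ 2) / 4 with hd
  have hM0 : 2 < M := by
    rw [hM, lt_div_iff₀ (by linarith)]
    linarith
  have hd0 : 0 < d := by
    rw [hd]
    nlinarith
  have hd1 : d < 1 := by
    rw [hd]
    nlinarith
  set h : ℝ := 1 / (2 * M ^ 2) with hh
  have hM2 : 0 < M ^ 2 := by positivity
  have hh0 : 0 < h := by positivity
  have hhM : h * M ^ 2 = 1 / 2 := by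
    rw [hh]
    field_simp
  have hh1 : h < 1 / 8 := by nlinarith
  -- On the disc, the denominator has modulus at most `2`, so `κ ^ 2 = 1 - h d / 2` will do.
  refine ⟨h, √(1 - h * d / 2), Real.sqrt_pos.2 (by nlinarith), ?_, fun z hz => ?_⟩
  · rw [Real.sqrt_lt' one_pos]
    nlinarith [mul_pos hh0 hd0]
  obtain ⟨hzM, hzd⟩ := bounds_of_norm_sub_one_le hq0 hq1 hz
  rw [← hM] at hzM
  rw [← hd] at hzd
  have hz2 : h * ‖z‖ ^ 2 ≤ 1 / 2 := by
    rw [← hhM]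
    gcongr
  set A : ℂ := 1 - h * z ^ 2 - h * z
  set B : ℂ := 1 - h * z ^ 2 + h * z
  have e1 : eulerStep h z - 1 = (z - 1) * A := by
    simp only [eulerStep, A]
    ring
  have e2 : eulerStep h z + 1 = (z + 1) * B := by
    simp only [eulerStep, B]
    ring
  have hdiff : ‖B‖ ^ 2 - ‖A‖ ^ 2 = 4 * h * (1 - h * ‖z‖ ^ 2) * z.re := by
    simp only [← Complex.normSq_eq_norm_sq, Complex.normSq_apply, A, B]
    simp [pow_two]
    ring
  have hB : ‖B‖ ≤ 2 := by
    have h1 : ‖B‖ ≤ ‖(1 : ℂ)‖ + ‖(h : ℂ) * z ^ 2‖ + ‖(h : ℂ) * z‖ :=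
      (norm_add_le _ _).trans (by gcongr; exact norm_sub_le _ _)
    have h2 : ‖(h : ℂ) * z ^ 2‖ = h * ‖z‖ ^ 2 := by
      rw [norm_mul, norm_pow, Complex.norm_real, Real.norm_of_nonneg hh0.le]
    have h3 : ‖(h : ℂ) * z‖ = h * ‖z‖ := by
      rw [norm_mul, Complex.norm_real, Real.norm_of_nonneg hh0.le]
    rw [h2, h3, norm_one] at h1
    nlinarith [mul_le_mul_of_nonneg_left hzM hh0.le]
  have hA : ‖A‖ ^ 2 ≤ (1 - h * d / 2) * ‖B‖ ^ 2 := by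
    have h1 : 2 * h * d ≤ ‖B‖ ^ 2 - ‖A‖ ^ 2 := by
      rw [hdiff]
      have : d * (1 / 2) ≤ z.re * (1 - h * ‖z‖ ^ 2) := by
        gcongr
        · linarith
        · linarith
      nlinarith
    have h2 : ‖B‖ ^ 2 ≤ 4 := by nlinarith [norm_nonneg B]
    nlinarith [mul_pos hh0 hd0]
  have hA' : ‖A‖ ≤ √(1 - h * d / 2) * ‖B‖ := by
    refine (pow_le_pow_iff_left₀ (norm_nonneg _) (by positivity) two_ne_zero).1 ?_
    rwa [mul_pow, Real.sq_sqrt (by nlinarith)]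
  rw [e1, e2, norm_mul, norm_mul]
  calc ‖z - 1‖ * ‖A‖ * ‖z + 1‖ = ‖z - 1‖ * ‖z + 1‖ * ‖A‖ := by ring
    _ ≤ ‖z - 1‖ * ‖z + 1‖ * (√(1 - h * d / 2) * ‖B‖) := by gcongr
    _ = _ := by ring

lemma eulerStep_iterate_bound {q h κ : ℝ} (hq0 : 0 < q) (hq1 : q < 1) (hκ0 : 0 < κ) (hκ1 : κ < 1)
    (hc : ∀ z : ℂ, ‖z - 1‖ ≤ q * ‖z + 1‖ →
      ‖eulerStep h z - 1‖ * ‖z + 1‖ ≤ κ * (‖eulerStep h z + 1‖ * ‖z - 1‖))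
    (n : ℕ) {z : ℂ} (hz : ‖z - 1‖ ≤ q * ‖z + 1‖) :
    ‖(eulerStep h)^[n] z - 1‖ ≤ κ ^ n * q * ‖(eulerStep h)^[n] z + 1‖ := by
  induction n with
  | zero => simpa using hz
  | succ n ih =>
    rw [Function.iterate_succ_apply']
    set w := (eulerStep h)^[n] z
    have hκn : κ ^ n ≤ 1 := pow_le_one₀ hκ0.le hκ1.le
    have hw : ‖w - 1‖ ≤ q * ‖w + 1‖ := ih.trans (by gcongr; nlinarith)
    have hw1 : 0 < ‖w + 1‖ := by
      have := (bounds_of_norm_sub_one_le hq0 hq1 hw).2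
      rw [norm_pos_iff]
      intro h0
      have h2 : w.re = -1 := by
        have := congrArg Complex.re h0
        simp at this
        linarith
      nlinarith
    refine le_of_mul_le_mul_right ((hc w hw).trans ?_) hw1
    calc κ * (‖eulerStep h w + 1‖ * ‖w - 1‖)
        ≤ κ * (‖eulerStep h w + 1‖ * (κ ^ n * q * ‖w + 1‖)) := by gcongr
      _ = _ := by ring

/-- Entire functions approximate, uniformly on bounded sets, the function that is `0` to the left
and `1` to the right of a vertical strip. -/
lemma exists_entire_step {d M ε : ℝ} (hd : 0 < d) (hM : 0 < M) (hε : 0 < ε) :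
    ∃ ψ : ℂ → ℂ, Differentiable ℂ ψ ∧ (∀ z : ℂ, ‖z‖ ≤ M → d ≤ z.re → ‖ψ z - 1‖ < ε) ∧
      ∀ z : ℂ, ‖z‖ ≤ M → z.re ≤ -d → ‖ψ z‖ < ε := by
  obtain ⟨q, hq0, hq1, hq⟩ : ∃ q : ℝ, 0 < q ∧ q < 1 ∧
      ∀ z : ℂ, ‖z‖ ≤ M → d ≤ z.re → ‖z - 1‖ ≤ q * ‖z + 1‖ := by
    set D := d / (d + (M + 1) ^ 2) with hD
    have hD0 : 0 < D := by positivity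
    have hD1 : D < 1 := by
      rw [hD, div_lt_one (by positivity)]
      nlinarith
    have hDM : D * (M + 1) ^ 2 ≤ d := by
      rw [hD, div_mul_eq_mul_div, div_le_iff₀ (by positivity)]
      nlinarith [sq_nonneg (M + 1)]
    refine ⟨√(1 - D), Real.sqrt_pos.2 (by linarith), ?_, fun z hz hzd => ?_⟩
    · rw [Real.sqrt_lt' one_pos]
      linarith
    · refine (pow_le_pow_iff_left₀ (norm_nonneg _) (by positivity) two_ne_zero).1 ?_
      rw [mul_pow, Real.sq_sqrt (by linarith)]
      have h1 : ‖z + 1‖ ^ 2 ≤ (M + 1) ^ 2 := by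
        gcongr
        exact (norm_add_le _ _).trans (by simpa using hz)
      have h2 : ‖z - 1‖ ^ 2 = ‖z + 1‖ ^ 2 - 4 * z.re := by
        rw [norm_sub_one_sq, norm_add_one_sq]
        ring
      nlinarith [mul_le_mul_of_nonneg_left h1 hD0.le]
  obtain ⟨h, κ, hκ0, hκ1, hc⟩ := exists_eulerStep_contraction hq0 hq1
  have hmin : 0 < min ε 1 / 4 := by positivity
  obtain ⟨n, hn⟩ := exists_pow_lt_of_lt_one hmin hκ1
  have key : ∀ z : ℂ, ‖z‖ ≤ M → d ≤ z.re → ‖(eulerStep h)^[n] z - 1‖ < ε := by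
    intro z hz hzd
    have h1 := eulerStep_iterate_bound hq0 hq1 hκ0 hκ1 hc n (hq z hz hzd)
    set w := (eulerStep h)^[n] z
    have h2 : ‖w + 1‖ ≤ ‖w - 1‖ + 2 := by
      calc ‖w + 1‖ = ‖(w - 1) + 2‖ := by ring_nf
        _ ≤ _ := by simpa using norm_add_le (w - 1) 2
    have h3 : κ ^ n * q < min ε 1 / 4 := by
      have : 0 < κ ^ n := by positivity
      nlinarith
    have h4 : ‖w - 1‖ ≤ min ε 1 / 4 * (‖w - 1‖ + 2) :=
      h1.trans (mul_le_mul h3.le h2 (norm_nonneg _) hmin.le)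
    have h5 := min_le_left ε 1
    have h6 := min_le_right ε 1
    have h7 : 0 < min ε 1 := by positivity
    nlinarith [mul_nonneg (norm_nonneg (w - 1)) (sub_nonneg.2 h6)]
  refine ⟨fun z => (1 + (eulerStep h)^[n] z) / 2,
    ((differentiable_eulerStep_iterate h n).const_add 1).div_const 2, fun z hz hzd => ?_,
    fun z hz hzd => ?_⟩
  · have e : (1 + (eulerStep h)^[n] z) / 2 - 1 = ((eulerStep h)^[n] z - 1) / 2 := by ring
    rw [e, norm_div, Complex.norm_two]
    linarith [key z hz hzd]
  · have h1 := key (-z) (by simpa using hz) (by simp; linarith)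
    rw [eulerStep_iterate_neg] at h1
    have e : (1 + (eulerStep h)^[n] z) / 2 = -((-(eulerStep h)^[n] z - 1) / 2) := by ring
    change ‖(1 + (eulerStep h)^[n] z) / 2‖ < ε
    rw [e, norm_neg, norm_div, Complex.norm_two]
    linarith

/-! ### Simultaneous approximation by entire functions -/

/-- `Approximable G`: the prescribed pairs (point, value) in `G` are met, up to any uniform error, by
a single entire function. The data are a set of pairs rather than a function on a set, so that
values prescribed on several sets can be put together by taking unions. -/
def Approximable (G : Set (ℂ × ℂ)) : Prop :=
  ∀ ε > 0, ∃ h : ℂ → ℂ, Differentiable ℂ h ∧ ∀ p ∈ G, ‖h p.1 - p.2‖ < ε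

lemma Approximable.mono {G G' : Set (ℂ × ℂ)} (h : Approximable G') (hG : G ⊆ G') :
    Approximable G := fun ε hε =>
  (h ε hε).imp fun _ hh => ⟨hh.1, fun p hp => hh.2 p (hG hp)⟩

lemma approximable_empty : Approximable ∅ :=
  fun _ _ => ⟨fun _ => 0, differentiable_const 0, fun _ hp => hp.elim⟩

/-- The values of an entire function `g` on the disc of radius `r` around `0`, moved to the disc of
radius `r` around `c`. -/
def discData (g : ℂ → ℂ) (r : ℝ) (c : ℂ) : Set (ℂ × ℂ) :=
  {p | ‖p.1 - c‖ ≤ r ∧ p.2 = g (p.1 - c)}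

lemma approximable_discData {g : ℂ → ℂ} (hg : Differentiable ℂ g) (r : ℝ) (c : ℂ) :
    Approximable (discData g r c) := fun ε hε =>
  ⟨fun z => g (z - c), hg.comp (differentiable_id.sub_const c), fun p hp => by
    simpa [hp.2] using hε⟩

/-- Approximable data over two bounded sets that are separated by a strip can be joined: with `ψ`
close to the step function across the strip, `h₁ + ψ (h₂ - h₁)` is close to `h₁` on one side and to
`h₂` on the other. -/
lemma Approximable.union {G₁ G₂ : Set (ℂ × ℂ)} (hG₁ : Approximable G₁) (hG₂ : Approximable G₂)
    {M : ℝ} (hM₁ : ∀ p ∈ G₁, ‖p.1‖ ≤ M) (hM₂ : ∀ p ∈ G₂, ‖p.1‖ ≤ M) {u : ℂ} {s t : ℝ} (hst : s < t)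
    (hs : ∀ p ∈ G₁, (u * p.1).re ≤ s) (ht : ∀ p ∈ G₂, t ≤ (u * p.1).re) :
    Approximable (G₁ ∪ G₂) := by
  intro ε hε
  obtain ⟨h₁, hd₁, hh₁⟩ := hG₁ (ε / 2) (by positivity)
  obtain ⟨h₂, hd₂, hh₂⟩ := hG₂ (ε / 2) (by positivity)
  obtain ⟨B, hB⟩ := (isCompact_closedBall (0 : ℂ) M).exists_bound_of_continuousOn
    (hd₂.continuous.sub hd₁.continuous).continuousOn
  have hB' : ∀ z : ℂ, ‖z‖ ≤ M → ‖h₂ z - h₁ z‖ ≤ max B 1 := fun z hz =>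
    (hB z (by simpa using hz)).trans (le_max_left _ _)
  have hB0 : 0 < max B 1 := by positivity
  set m : ℝ := (s + t) / 2
  set M' : ℝ := ‖u‖ * |M| + |m| + 1
  obtain ⟨ψ, hψ, hψ₂, hψ₁⟩ := exists_entire_step (d := (t - s) / 2) (M := M')
    (ε := ε / 2 / max B 1) (by linarith) (by positivity) (by positivity)
  have hbd : ∀ z : ℂ, ‖z‖ ≤ M → ‖u * z - m‖ ≤ M' := by
    intro z hz
    calc ‖u * z - m‖ ≤ ‖u * z‖ + ‖(m : ℂ)‖ := norm_sub_le _ _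
      _ ≤ ‖u‖ * |M| + |m| := by
        rw [norm_mul, Complex.norm_real, Real.norm_eq_abs]
        gcongr
        exact hz.trans (le_abs_self M)
      _ ≤ M' := by simp [M']
  have hre : ∀ z : ℂ, (u * z - m).re = (u * z).re - m := fun z => by simp
  have hsmall : ∀ x y : ℂ, ‖x‖ < ε / 2 / max B 1 → ‖y‖ ≤ max B 1 → ‖x * y‖ ≤ ε / 2 := by
    intro x y hx hy
    rw [norm_mul]
    calc ‖x‖ * ‖y‖ ≤ ε / 2 / max B 1 * max B 1 := by gcongr
      _ = ε / 2 := by field_simp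
  refine ⟨fun z => h₁ z + ψ (u * z - m) * (h₂ z - h₁ z), ?_, ?_⟩
  · exact hd₁.add ((hψ.comp ((differentiable_id.const_mul u).sub_const _)).mul (hd₂.sub hd₁))
  · rintro ⟨z, w⟩ (hp | hp)
    · have e1 := hsmall _ _ (hψ₁ _ (hbd z (hM₁ _ hp)) (by
        rw [hre]
        simp only [m]
        linarith [hs _ hp])) (hB' z (hM₁ _ hp))
      have e2 := hh₁ _ hp
      calc ‖h₁ z + ψ (u * z - m) * (h₂ z - h₁ z) - w‖
          = ‖(h₁ z - w) + ψ (u * z - m) * (h₂ z - h₁ z)‖ := by ring_nf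
        _ ≤ _ := norm_add_le _ _
        _ < ε := by linarith
    · have e1 := hsmall _ _ (hψ₂ _ (hbd z (hM₂ _ hp)) (by
        rw [hre]
        simp only [m]
        linarith [ht _ hp])) (hB' z (hM₂ _ hp))
      have e2 := hh₂ _ hp
      calc ‖h₁ z + ψ (u * z - m) * (h₂ z - h₁ z) - w‖
          = ‖(h₂ z - w) + (ψ (u * z - m) - 1) * (h₂ z - h₁ z)‖ := by ring_nf
        _ ≤ _ := norm_add_le _ _
        _ < ε := by linarith

/-- Finitely many approximable data over disjoint parallel strips, at positions `τ x`, can be joined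
one after the other. -/
lemma approximable_biUnion_strips (J : Finset ℤ) {G : ℤ → Set (ℂ × ℂ)}
    (hG : ∀ x ∈ J, Approximable (G x))
    {M : ℝ} (hM : ∀ x ∈ J, ∀ p ∈ G x, ‖p.1‖ ≤ M) (u : ℂ) {τ : ℤ → ℝ} {r : ℝ}
    (hτ : ∀ x ∈ J, ∀ y ∈ J, x < y → τ x + 2 * r < τ y)
    (hu : ∀ x ∈ J, ∀ p ∈ G x, |(u * p.1).re - τ x| ≤ r) :
    Approximable (⋃ x ∈ J, G x) := by
  induction J using Finset.induction_on_max with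
  | empty => simpa using approximable_empty
  | insert a J hJ ih =>
    have ih' := ih (fun x hx => hG x (Finset.mem_insert_of_mem hx))
      (fun x hx => hM x (Finset.mem_insert_of_mem hx))
      (fun x hx y hy => hτ x (Finset.mem_insert_of_mem hx) y (Finset.mem_insert_of_mem hy))
      (fun x hx => hu x (Finset.mem_insert_of_mem hx))
    have hGa := hG a (Finset.mem_insert_self _ _)
    rcases J.eq_empty_or_nonempty with rfl | hne
    · simpa using hGa
    rw [Finset.set_biUnion_insert, Set.union_comm]
    have hb : J.max' hne ∈ J := J.max'_mem hne
    have hba := hτ _ (Finset.mem_insert_of_mem hb) a (Finset.mem_insert_self _ _) (hJ _ hb)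
    refine ih'.union hGa (M := M) (u := u) (s := τ (J.max' hne) + r) (t := τ a - r) ?_ ?_
      (by linarith) ?_ ?_
    · intro p hp
      obtain ⟨x, hx, hp⟩ := Set.mem_iUnion₂.1 hp
      exact hM x (Finset.mem_insert_of_mem hx) p hp
    · exact hM a (Finset.mem_insert_self _ _)
    · intro p hp
      obtain ⟨x, hx, hp⟩ := Set.mem_iUnion₂.1 hp
      have h1 := (abs_le.1 (hu x (Finset.mem_insert_of_mem hx) p hp)).2
      have h0 : 0 ≤ r := (abs_nonneg _).trans (hu x (Finset.mem_insert_of_mem hx) p hp)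
      have h2 : τ x ≤ τ (J.max' hne) := by
        rcases (J.le_max' x hx).eq_or_lt with h | h
        · exact h ▸ le_rfl
        · have := hτ x (Finset.mem_insert_of_mem hx) _ (Finset.mem_insert_of_mem hb) h
          linarith
      linarith
    · intro p hp
      have h1 := (abs_le.1 (hu a (Finset.mem_insert_self _ _) p hp)).1
      linarith

/-- A function can be prescribed on finitely many discs centred at points of a square lattice: join
the discs of each row, then the rows. The residue classes `x % q = i`, `y % q = j` single out a
sublattice coarse enough for the discs to be disjoint. -/
lemma approximable_lattice {g : ℂ → ℂ} (hg : Differentiable ℂ g) {r : ℝ} (e v : ℂ) {q : ℕ}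
    (hv : 2 * r < ‖v‖ * q) (i j : ℤ) (J : Finset ℤ) :
    Approximable (⋃ y ∈ J.filter (fun y => y % q = j), ⋃ x ∈ J.filter (fun x => x % q = i),
      discData g r (e + v * (x + y * Complex.I))) := by
  rcases lt_or_ge r 0 with hr | hr
  · refine approximable_empty.mono fun p hp => ?_
    simp only [Set.mem_iUnion] at hp
    obtain ⟨y, -, x, -, hp⟩ := hp
    exact absurd (norm_nonneg (p.1 - _)) (by linarith [hp.1])
  have hv0 : 0 < ‖v‖ := by
    rcases (norm_nonneg v).eq_or_lt with h | h
    · rw [← h] at hv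
      linarith
    · exact h
  -- Distinct integers of the same class differ by at least `q`.
  have hgap : ∀ k : ℤ, ∀ x ∈ J.filter (fun x => x % q = k), ∀ y ∈ J.filter (fun x => x % q = k),
      ∀ b : ℝ, x < y → ‖v‖ ^ 2 * x + b + 2 * (‖v‖ * r) < ‖v‖ ^ 2 * y + b := by
    intro k x hx y hy b hxy
    rw [Finset.mem_filter] at hx hy
    have h1 : (q : ℤ) ∣ y - x := Int.ModEq.dvd (hx.2.trans hy.2.symm)
    have h2 : (q : ℤ) ≤ y - x := Int.le_of_dvd (by omega) h1
    have h3 : (q : ℝ) ≤ y - x := by exact_mod_cast h2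
    nlinarith [mul_le_mul_of_nonneg_left h3 (sq_nonneg ‖v‖), mul_lt_mul_of_pos_left hv hv0]
  have hdev : ∀ u : ℂ, ‖u‖ = ‖v‖ → ∀ c z : ℂ, ‖z - c‖ ≤ r → |(u * z).re - (u * c).re| ≤ ‖v‖ * r := by
    intro u hu c z hz
    rw [← Complex.sub_re, ← mul_sub]
    refine (Complex.abs_re_le_norm _).trans ?_
    rw [norm_mul, hu]
    gcongr
  have hconj : (starRingEnd ℂ) v * v = ((‖v‖ ^ 2 : ℝ) : ℂ) := by
    rw [mul_comm, Complex.mul_conj, Complex.normSq_eq_norm_sq]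
  set w : ℂ := (starRingEnd ℂ) v
  obtain ⟨M, hM⟩ : ∃ M : ℝ, ∀ y ∈ J, ∀ x ∈ J, ∀ p ∈ discData g r (e + v * (x + y * Complex.I)),
      ‖p.1‖ ≤ M := by
    refine ⟨∑ y ∈ J, ∑ x ∈ J, ‖e + v * (x + y * Complex.I)‖ + r, fun y hy x hx p hp => ?_⟩
    have h1 : ‖e + v * (x + y * Complex.I)‖ ≤ ∑ y ∈ J, ∑ x ∈ J, ‖e + v * (x + y * Complex.I)‖ :=
      (Finset.single_le_sum (f := fun x : ℤ => ‖e + v * (x + y * Complex.I)‖)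
        (fun _ _ => norm_nonneg _) hx).trans
      (Finset.single_le_sum (f := fun y : ℤ => ∑ x ∈ J, ‖e + v * (x + y * Complex.I)‖)
        (fun _ _ => Finset.sum_nonneg fun _ _ => norm_nonneg _) hy)
    have h2 : ‖p.1‖ ≤ ‖p.1 - (e + v * (x + y * Complex.I))‖ + ‖e + v * (x + y * Complex.I)‖ := by
      simpa using norm_add_le (p.1 - (e + v * (x + y * Complex.I))) (e + v * (x + y * Complex.I))
    linarith [hp.1]
  have hre : ∀ x y : ℤ, (w * (e + v * (x + y * Complex.I))).re = ‖v‖ ^ 2 * x + (w * e).re := by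
    intro x y
    rw [show w * (e + v * (x + y * Complex.I)) = w * e + w * v * (x + y * Complex.I) by ring, hconj,
      Complex.add_re, Complex.re_ofReal_mul]
    simp
    ring
  have hre' : ∀ x y : ℤ, (-Complex.I * w * (e + v * (x + y * Complex.I))).re =
      ‖v‖ ^ 2 * y + (-Complex.I * w * e).re := by
    intro x y
    rw [show -Complex.I * w * (e + v * (x + y * Complex.I)) =
      -Complex.I * w * e + w * v * (-Complex.I * (x + y * Complex.I)) by ring, hconj,
      Complex.add_re, Complex.re_ofReal_mul]
    simp
    ring
  have hw : ‖w‖ = ‖v‖ := Complex.norm_conj v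
  refine approximable_biUnion_strips _ (M := M) (fun y hy => ?_) ?_ (-Complex.I * w)
    (τ := fun y => ‖v‖ ^ 2 * y + (-Complex.I * w * e).re) (r := ‖v‖ * r)
    (fun x hx y hy hxy => hgap j x hx y hy _ hxy) ?_
  · refine approximable_biUnion_strips _ (M := M) (fun x _ => approximable_discData hg r _) ?_ w
      (τ := fun x => ‖v‖ ^ 2 * x + (w * e).re) (r := ‖v‖ * r)
      (fun x hx y hy hxy => hgap i x hx y hy _ hxy) ?_
    · intro x hx p hp
      exact hM y (Finset.mem_filter.1 hy).1 x (Finset.mem_filter.1 hx).1 p hp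
    · intro x hx p hp
      have := hdev w hw _ _ hp.1
      rwa [hre] at this
  · intro y hy p hp
    obtain ⟨x, hx, hp⟩ := Set.mem_iUnion₂.1 hp
    exact hM y (Finset.mem_filter.1 hy).1 x (Finset.mem_filter.1 hx).1 p hp
  · intro y hy p hp
    obtain ⟨x, hx, hp⟩ := Set.mem_iUnion₂.1 hp
    have := hdev (-Complex.I * w) (by simp [hw]) _ _ hp.1
    rwa [hre'] at this

/-- Approximable data can be joined one after the other if each set lies beyond a line which has all
the earlier ones, contained in discs around `0`, on its other side. -/
lemma approximable_biUnion_of_radii {G : ℕ → Set (ℂ × ℂ)} (hG : ∀ i, Approximable (G i)) {R : ℕ → ℝ}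
    {n : ℕ} (hR : ∀ i < n, R i ≤ R (i + 1)) (hGR : ∀ i ≤ n, ∀ p ∈ G i, ‖p.1‖ ≤ R i)
    (hsep : ∀ i < n, ∃ u : ℂ, ‖u‖ = 1 ∧ ∃ t, R i < t ∧ ∀ p ∈ G (i + 1), t ≤ (u * p.1).re) :
    Approximable (⋃ i ≤ n, G i) := by
  have hbd : ∀ m ≤ n, ∀ i ≤ m, ∀ p ∈ G i, ‖p.1‖ ≤ R m := by
    intro m
    induction m with
    | zero =>
      intro hm i hi p hp
      obtain rfl : i = 0 := by omega
      exact hGR 0 hm p hp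
    | succ m ih =>
      intro hm i hi p hp
      rcases hi.eq_or_lt with rfl | hi
      · exact hGR _ hm p hp
      · exact (ih (by omega) i (by omega) p hp).trans (hR m (by omega))
  suffices h : ∀ m ≤ n, Approximable (⋃ i ≤ m, G i) from h n le_rfl
  intro m
  induction m with
  | zero => exact fun _ => by simpa using hG 0
  | succ m ih =>
    intro hm
    obtain ⟨u, hu, t, hRt, ht⟩ := hsep m (by omega)
    rw [Set.biUnion_le_succ]
    refine (ih (by omega)).union (hG (m + 1)) (M := R (m + 1)) ?_ (hGR _ hm) hRt ?_ ht
    · intro p hp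
      obtain ⟨i, hi, hp⟩ := Set.mem_iUnion₂.1 hp
      exact hbd _ hm i (by omega) p hp
    · intro p hp
      obtain ⟨i, hi, hp⟩ := Set.mem_iUnion₂.1 hp
      refine (Complex.re_le_norm _).trans ?_
      rw [norm_mul, hu, one_mul]
      exact hbd m (by omega) i hi p hp

/-! ### Slowly growing subsequences -/

/-- If `lam (n + 1) / lam n → 1` and `‖lam n‖ → ∞`, then from any late term one can pass to a later
one whose modulus is larger by a factor between `1 + θ` and `1 + 2 θ`, again and again. -/
lemma exists_slow_subsequence {lam : ℕ+ → ℂ} (hne : ∀ n, lam n ≠ 0)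
    (hinf : Tendsto (fun n => ‖lam n‖) atTop atTop)
    (hratio : Tendsto (fun n => lam (n + 1) / lam n) atTop (𝓝 1)) {θ : ℝ} (hθ : 0 < θ) (T : ℝ) :
    ∃ n : ℕ → ℕ+, T ≤ ‖lam (n 0)‖ ∧ ∀ i, (1 + θ) * ‖lam (n i)‖ ≤ ‖lam (n (i + 1))‖ ∧
      ‖lam (n (i + 1))‖ ≤ (1 + 2 * θ) * ‖lam (n i)‖ := by
  have hpos : ∀ n, 0 < ‖lam n‖ := fun n => norm_pos_iff.2 (hne n)
  have hfac : 1 < (1 + 2 * θ) / (1 + θ) := by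
    rw [lt_div_iff₀ (by linarith)]
    linarith
  have hr : ∀ᶠ n in atTop, ‖lam (n + 1)‖ ≤ (1 + 2 * θ) / (1 + θ) * ‖lam n‖ := by
    have h1 := hratio.norm
    rw [norm_one] at h1
    filter_upwards [h1.eventually_lt_const hfac] with n hn
    rw [norm_div, div_lt_iff₀ (hpos n)] at hn
    exact hn.le
  obtain ⟨N, hN⟩ := eventually_atTop.1 hr
  have hstep : ∀ n ≥ N, ∃ m ≥ N, (1 + θ) * ‖lam n‖ ≤ ‖lam m‖ ∧
      ‖lam m‖ ≤ (1 + 2 * θ) * ‖lam n‖ := by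
    intro n hn
    -- The first later term that is large enough is not too large.
    have hex : ∃ m : ℕ, (1 + θ) * ‖lam n‖ ≤ ‖lam (n + m.succPNat)‖ := by
      obtain ⟨m, hm⟩ := eventually_atTop.1 (hinf.eventually_ge_atTop ((1 + θ) * ‖lam n‖))
      exact ⟨m.natPred, by simpa using hm (n + m) (PNat.lt_add_left m n).le⟩
    classical
    have h1 := Nat.find_spec hex
    refine ⟨n + (Nat.find hex).succPNat, hn.trans (PNat.lt_add_right _ _).le, h1, ?_⟩
    suffices h : ∃ k ≥ N, k + 1 = n + (Nat.find hex).succPNat ∧ ‖lam k‖ ≤ (1 + θ) * ‖lam n‖ by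
      obtain ⟨k, hk, hkn, hkl⟩ := h
      rw [← hkn]
      calc ‖lam (k + 1)‖ ≤ (1 + 2 * θ) / (1 + θ) * ‖lam k‖ := hN k hk
        _ ≤ (1 + 2 * θ) / (1 + θ) * ((1 + θ) * ‖lam n‖) := by gcongr
        _ = _ := by field_simp
    rcases h0 : Nat.find hex with _ | m
    · exact ⟨n, hn, rfl, by nlinarith [hpos n]⟩
    · refine ⟨n + m.succPNat, hn.trans (PNat.lt_add_right _ _).le, ?_, ?_⟩
      · rw [← PNat.coe_inj]
        simp
        omega
      · have := Nat.find_min hex (m := m) (by omega)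
        exact (not_le.1 this).le
  obtain ⟨n₀, hn₀N, hn₀T⟩ := ((eventually_ge_atTop N).and (hinf.eventually_ge_atTop T)).exists
  choose! f hfN hf using hstep
  have hge : ∀ i, f^[i] n₀ ≥ N := by
    intro i
    induction i with
    | zero => exact hn₀N
    | succ i ih =>
      rw [Function.iterate_succ_apply']
      exact hfN _ ih
  refine ⟨fun i => f^[i] n₀, hn₀T, fun i => ?_⟩
  simp only [Function.iterate_succ_apply']
  exact hf _ (hge i)

/-- A sequence whose increments tend to infinity tends to infinity. -/
lemma tendsto_norm_atTop_of_sub {lam : ℕ+ → ℂ}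
    (h : Tendsto (fun n => ‖lam (n + 1)‖ - ‖lam n‖) atTop atTop) :
    Tendsto (fun n => ‖lam n‖) atTop atTop := by
  obtain ⟨N, hN⟩ := eventually_atTop.1 (h.eventually_ge_atTop 1)
  have key : ∀ n ≥ N, (n : ℝ) - N ≤ ‖lam n‖ := by
    intro n
    induction n using PNat.recOn with
    | one =>
      intro hn
      have : (N : ℝ) = 1 := by
        have : N = 1 := le_antisymm hn (one_le)
        simp [this]
      simp [this]
    | succ n ih =>
      intro hn
      rcases hn.lt_or_eq with h1 | h1
      · have h2 : N ≤ n := PNat.lt_add_one_iff.1 h1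
        have h3 := hN n h2
        have h4 := ih h2
        push_cast
        linarith
      · rw [← h1]
        simp
  have hcast : Tendsto (fun n : ℕ+ => (n : ℝ)) atTop atTop :=
    tendsto_natCast_atTop_atTop.comp tendsto_PNat_val_atTop_atTop
  refine tendsto_atTop_mono' _ ?_ (tendsto_atTop_add_const_right _ (-(N : ℝ)) hcast)
  filter_upwards [eventually_ge_atTop N] with n hn
  simpa [sub_eq_add_neg] using key n hn

/-! ### The topology of the space of entire functions -/

/-- Closeness on a large enough disc forces membership in a given neighbourhood. -/
lemma exists_disc_of_mem_open {V : Set EntireFun} (hV : IsOpen V) {g : EntireFun} (hg : g ∈ V) :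
    ∃ ρ > 0, ∃ ε > 0, ∀ f : EntireFun,
      (∀ z : ℂ, ‖z‖ ≤ ρ → ‖(f : C(ℂ, ℂ)) z - (g : C(ℂ, ℂ)) z‖ < ε) → f ∈ V := by
  obtain ⟨W, hW, rfl⟩ := isOpen_induced_iff.1 hV
  obtain ⟨⟨K, U⟩, ⟨hK, hU⟩, hKU⟩ := (nhds_basis_uniformity
    (ContinuousMap.hasBasis_compactConvergenceUniformity (α := ℂ) (β := ℂ))).mem_iff.1
    (hW.mem_nhds hg)
  obtain ⟨ε, hε, hεU⟩ := Metric.mem_uniformity_dist.1 hU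
  obtain ⟨ρ, hρ, hKρ⟩ := hK.isBounded.subset_closedBall_lt 0 0
  refine ⟨ρ, hρ, ε, hε, fun f hf => hKU fun z hz => hεU ?_⟩
  rw [dist_eq_norm]
  exact hf z (by simpa using hKρ hz)

lemma isClosed_entireFun : IsClosed (EntireFun : Set C(ℂ, ℂ)) := by
  refine isClosed_of_closure_subset fun f hf => ?_
  obtain ⟨u, hu, hlim⟩ := mem_closure_iff_seq_limit.1 hf
  rw [ContinuousMap.tendsto_iff_tendstoLocallyUniformly, ← tendstoLocallyUniformlyOn_univ] at hlim
  exact differentiableOn_univ.1 (hlim.differentiableOn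
    (Eventually.of_forall fun n => (hu n).differentiableOn) isOpen_univ)

instance : CompleteSpace EntireFun := isClosed_entireFun.completeSpace_coe

instance : BaireSpace EntireFun := by
  have : (uniformity EntireFun).IsCountablyGenerated := Filter.comap.isCountablyGenerated _ _
  infer_instance

lemma continuous_translation_uncurry :
    Continuous fun p : ℂ × EntireFun => translation p.1 p.2 := by
  have h1 : Continuous shift := by
    refine ContinuousMap.continuous_of_continuous_uncurry _ ?_
    exact continuous_snd.add continuous_fst
  exact ((continuous_subtype_val.comp continuous_snd).compCM (h1.comp continuous_fst)).subtype_mk _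

/-- The functions some translate of which, along `lam n * a`, lies in `V`, for each `a` in `K`. -/
def hitSet (lam : ℕ+ → ℂ) (K : Set ℂ) (V : Set EntireFun) : Set EntireFun :=
  {f | ∀ a ∈ K, ∃ n, translation (lam n * a) f ∈ V}

lemma isOpen_hitSet (lam : ℕ+ → ℂ) {K : Set ℂ} (hK : IsCompact K) {V : Set EntireFun}
    (hV : IsOpen V) : IsOpen (hitSet lam K V) := by
  rw [isOpen_iff_mem_nhds]
  intro f hf
  refine hK.eventually_forall_of_forall_eventually
    (P := fun (f : EntireFun) (a : ℂ) => ∃ n, translation (lam n * a) f ∈ V) fun a ha => ?_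
  obtain ⟨n, hn⟩ := hf a ha
  have hc : Continuous fun p : EntireFun × ℂ => translation (lam n * p.2) p.1 :=
    continuous_translation_uncurry.comp ((continuous_const.mul continuous_snd).prodMk continuous_fst)
  filter_upwards [hc.continuousAt.preimage_mem_nhds (hV.mem_nhds hn)] with p hp
  exact ⟨n, hp⟩

/-! ### Functions with prescribed translates -/

/-- The `q ^ 2` pairs of residues modulo `q` are numbered as `(i / q, i % q)` for `i < q ^ 2`. -/
lemma exists_residue_index {q : ℕ} (hq : 0 < q) (x y : ℤ) :
    ∃ i < q * q, x % q = (i / q : ℕ) ∧ y % q = (i % q : ℕ) := by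
  have hq' : (q : ℤ) ≠ 0 := by omega
  have hx := Int.emod_nonneg x hq'
  have hy := Int.emod_nonneg y hq'
  have hx' := Int.emod_lt_of_pos x (by omega : (0 : ℤ) < q)
  have hy' := Int.emod_lt_of_pos y (by omega : (0 : ℤ) < q)
  obtain ⟨b, hb⟩ := Int.eq_ofNat_of_zero_le hx
  obtain ⟨c, hc⟩ := Int.eq_ofNat_of_zero_le hy
  rw [hb] at hx' ⊢
  rw [hc] at hy' ⊢
  have hb' : b < q := by exact_mod_cast hx'
  have hc' : c < q := by exact_mod_cast hy'
  refine ⟨q * b + c, by nlinarith, ?_, ?_⟩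
  · rw [Nat.mul_add_div hq, Nat.div_eq_of_lt hc', add_zero]
  · rw [Nat.mul_add_mod, Nat.mod_eq_of_lt hc']

/-- A sublattice of mesh `q s` around `a₀`, given by the `i`-th pair of residues modulo `q`, cut off
at distance `2 η` and scaled by `l`, with the values of `g` moved to discs around its points. -/
def levelData (g : ℂ → ℂ) (r : ℝ) (a₀ : ℂ) (s η : ℝ) (q : ℕ) (l : ℂ) (i : ℕ) : Set (ℂ × ℂ) :=
  {p | ∃ x y : ℤ, x % q = (i / q : ℕ) ∧ y % q = (i % q : ℕ) ∧ ‖(s : ℂ) * (x + y * Complex.I)‖ ≤ 2 * η ∧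
    p ∈ discData g r (l * (a₀ + s * (x + y * Complex.I)))}

lemma approximable_levelData {g : ℂ → ℂ} (hg : Differentiable ℂ g) {r : ℝ} (a₀ : ℂ) {s : ℝ}
    (hs : 0 < s) (η : ℝ) {q : ℕ} {l : ℂ} (hl : 2 * r < ‖l‖ * s * q) (i : ℕ) :
    Approximable (levelData g r a₀ s η q l i) := by
  have hl' : 2 * r < ‖l * s‖ * q := by
    rwa [norm_mul, Complex.norm_real, Real.norm_of_nonneg hs.le]
  refine (approximable_lattice hg (l * a₀) (l * s) hl' (i / q : ℕ) (i % q : ℕ)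
    (Finset.Icc (-⌈2 * η / s⌉) ⌈2 * η / s⌉)).mono ?_
  rintro p ⟨x, y, hx, hy, hxy, hp⟩
  have hbound : ∀ k : ℤ, s * |(k : ℝ)| ≤ 2 * η → k ∈ Finset.Icc (-⌈2 * η / s⌉) ⌈2 * η / s⌉ := by
    intro k hk
    have h1 : |(k : ℝ)| ≤ ⌈2 * η / s⌉ := by
      refine le_trans ?_ (Int.le_ceil _)
      rw [le_div_iff₀ hs]
      linarith
    rw [Finset.mem_Icc, ← abs_le]
    exact_mod_cast h1
  rw [norm_mul, Complex.norm_real, Real.norm_of_nonneg hs.le] at hxy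
  simp only [Set.mem_iUnion, Finset.mem_filter]
  refine ⟨y, ⟨hbound y ?_, hy⟩, x, ⟨hbound x ?_, hx⟩, ?_⟩
  · refine le_trans ?_ hxy
    gcongr
    simpa using Complex.abs_im_le_norm (x + y * Complex.I)
  · refine le_trans ?_ hxy
    gcongr
    simpa using Complex.abs_re_le_norm (x + y * Complex.I)
  · convert hp using 2
    ring

lemma norm_sub_le_of_mem_levelData {g : ℂ → ℂ} {r : ℝ} {a₀ : ℂ} {s η : ℝ} {q : ℕ} {l : ℂ} {i : ℕ}
    {p : ℂ × ℂ} (hp : p ∈ levelData g r a₀ s η q l i) : ‖p.1 - l * a₀‖ ≤ r + ‖l‖ * (2 * η) := by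
  obtain ⟨x, y, -, -, hxy, hp⟩ := hp
  calc ‖p.1 - l * a₀‖ = ‖(p.1 - l * (a₀ + s * (x + y * Complex.I))) + l * (s * (x + y * Complex.I))‖ := by
        ring_nf
    _ ≤ r + ‖l‖ * (2 * η) := by
        refine (norm_add_le _ _).trans (add_le_add hp.1 ?_)
        rw [norm_mul l]
        gcongr

/-- The approximation step. Near `a₀` take a lattice of points `a'` so fine that `lam n * a` stays
within `δ` of `lam n * a'` for the nearest `a'`, as long as `‖lam n‖ ≤ 2 L`. The points of one class
modulo `q` remain far apart after multiplication by `lam n`, where `‖lam n‖ ≥ L`, so one index `n`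
can serve the whole class; and `q ^ 2` indices with moduli between `L` and `2 L` can be chosen whose
moduli grow fast enough for the images of the neighbourhood of `a₀` to lie in disjoint annuli. -/
lemma exists_entire_hitting {lam : ℕ+ → ℂ} (hne : ∀ n, lam n ≠ 0)
    (hinf : Tendsto (fun n => ‖lam n‖) atTop atTop)
    (hratio : Tendsto (fun n => lam (n + 1) / lam n) atTop (𝓝 1)) {a₀ : ℂ} (ha₀ : a₀ ≠ 0)
    {g : ℂ → ℂ} (hg : Differentiable ℂ g) {ρ ε : ℝ} (hρ : 0 < ρ) (hε : 0 < ε) :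
    ∃ η > 0, ∀ f₀ : ℂ → ℂ, Differentiable ℂ f₀ → ∀ R : ℝ, 0 < R → ∀ ε' > 0,
      ∃ f : ℂ → ℂ, Differentiable ℂ f ∧ (∀ z, ‖z‖ ≤ R → ‖f z - f₀ z‖ < ε') ∧
        ∀ a, ‖a - a₀‖ ≤ η → ∃ n, ∀ z, ‖z‖ ≤ ρ → ‖f (z + lam n * a) - g z‖ < ε := by
  set r : ℝ := ‖a₀‖ with hr
  have hr0 : 0 < r := norm_pos_iff.2 ha₀
  obtain ⟨δ, hδ0, hδ1, hδ⟩ : ∃ δ > 0, δ ≤ 1 ∧ ∀ z w : ℂ, ‖z‖ ≤ ρ → ‖w - z‖ ≤ δ →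
      ‖g w - g z‖ < ε / 2 := by
    have huc := (isCompact_closedBall (0 : ℂ) (ρ + 1)).uniformContinuousOn_of_continuous
      hg.continuous.continuousOn
    obtain ⟨d, hd, hd'⟩ := Metric.uniformContinuousOn_iff.1 huc (ε / 2) (by positivity)
    refine ⟨min (d / 2) 1, by positivity, min_le_right _ _, fun z w hz hw => ?_⟩
    have h1 : ‖w - z‖ ≤ 1 := hw.trans (min_le_right _ _)
    have h2 : ‖w - z‖ < d := (hw.trans (min_le_left _ _)).trans_lt (by linarith)
    have h3 : ‖w‖ ≤ ‖w - z‖ + ‖z‖ := by simpa using norm_add_le (w - z) z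
    rw [← dist_eq_norm]
    refine hd' w ?_ z ?_ (by rwa [dist_eq_norm])
    · rw [mem_closedBall_zero_iff]
      linarith
    · rw [mem_closedBall_zero_iff]
      linarith
  obtain ⟨q, hq⟩ := exists_nat_gt (4 * (ρ + 1) / δ)
  have hq0 : 0 < q := by
    have : (0 : ℝ) < q := lt_trans (by positivity) hq
    exact_mod_cast this
  rw [div_lt_iff₀ hδ0] at hq
  obtain ⟨θ, hθ0, hθ1, hθ⟩ : ∃ θ : ℝ, 0 < θ ∧ θ ≤ 1 ∧ (1 + 2 * θ) ^ (q * q) ≤ 2 := by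
    have hc : Tendsto (fun θ : ℝ => (1 + 2 * θ) ^ (q * q)) (𝓝[>] 0) (𝓝 1) := by
      have : Continuous fun θ : ℝ => (1 + 2 * θ) ^ (q * q) := by fun_prop
      simpa using (this.tendsto 0).mono_left nhdsWithin_le_nhds
    obtain ⟨θ, h1, h2⟩ := ((hc.eventually_le_const one_lt_two).and
      (Ioo_mem_nhdsGT one_pos)).exists
    exact ⟨θ, h2.1, h2.2.le, h1⟩
  set η : ℝ := θ * r / 8 with hη
  have hη0 : 0 < η := by positivity
  have hηr : 8 * η ≤ r := by
    rw [hη]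
    nlinarith
  have hgrow : r + 4 * η ≤ (1 + θ) * (r - 2 * η) := by
    have : θ * η ≤ η := by nlinarith
    nlinarith
  refine ⟨η, hη0, fun f₀ hf₀ R hR ε' hε' => ?_⟩
  obtain ⟨n, hn0, hn⟩ := exists_slow_subsequence hne hinf hratio hθ0
    ((R + 2 * (ρ + 1) + δ) / η)
  set L : ℝ := ‖lam (n 0)‖ with hL
  rw [div_le_iff₀ hη0] at hn0
  have hL0 : 0 < L := norm_pos_iff.2 (hne _)
  have hmono : ∀ i, ‖lam (n i)‖ ≤ ‖lam (n (i + 1))‖ := fun i =>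
    le_trans (by nlinarith [norm_nonneg (lam (n i))]) (hn i).1
  have hLn : ∀ i, L ≤ ‖lam (n i)‖ := by
    intro i
    induction i with
    | zero => exact le_rfl
    | succ i ih => exact ih.trans (hmono i)
  have hnL : ∀ i < q * q, ‖lam (n i)‖ ≤ 2 * L := by
    have h1 : ∀ i, ‖lam (n i)‖ ≤ (1 + 2 * θ) ^ i * L := by
      intro i
      induction i with
      | zero => simp [hL]
      | succ i ih =>
        calc ‖lam (n (i + 1))‖ ≤ (1 + 2 * θ) * ‖lam (n i)‖ := (hn i).2
          _ ≤ (1 + 2 * θ) * ((1 + 2 * θ) ^ i * L) := by gcongr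
          _ = _ := by ring
    intro i hi
    refine (h1 i).trans ?_
    gcongr
    exact (pow_le_pow_right₀ (by linarith) hi.le).trans hθ
  set s : ℝ := δ / (2 * L) with hs
  have hs0 : 0 < s := by positivity
  have hsL : s * (2 * L) = δ := by
    rw [hs]
    field_simp
  have hsη : s ≤ η := by
    rw [hs, div_le_iff₀ (by positivity)]
    nlinarith
  set lvl : ℕ → Set (ℂ × ℂ) := fun i => levelData g (ρ + 1) a₀ s η q (lam (n i)) i with hlvl
  have happ : Approximable (⋃ i ≤ q * q, (Nat.rec (discData f₀ R 0) (fun i _ => lvl i) i :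
      Set (ℂ × ℂ))) := by
    refine approximable_biUnion_of_radii (fun i => ?_)
      (R := fun i => Nat.rec R (fun i _ => ‖lam (n i)‖ * (r + 2 * η) + (ρ + 1)) i)
      (fun i _ => ?_) (fun i _ p hp => ?_) (fun i _ => ?_)
    · rcases i with _ | i
      · exact approximable_discData hf₀ R 0
      · refine approximable_levelData hg a₀ hs0 η ?_ i
        have : L * s * q ≤ ‖lam (n i)‖ * s * q := by
          gcongr
          exact hLn i
        nlinarith
    · rcases i with _ | i
      · change R ≤ L * (r + 2 * η) + (ρ + 1)
        nlinarith
      · change ‖lam (n i)‖ * (r + 2 * η) + (ρ + 1) ≤ ‖lam (n (i + 1))‖ * (r + 2 * η) + (ρ + 1)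
        gcongr
        exact hmono i
    · rcases i with _ | i
      · simpa using hp.1
      · have h1 := norm_sub_le_of_mem_levelData hp
        have h2 : ‖p.1‖ ≤ ‖p.1 - lam (n i) * a₀‖ + ‖lam (n i) * a₀‖ := by
          simpa using norm_add_le (p.1 - lam (n i) * a₀) (lam (n i) * a₀)
        rw [norm_mul, ← hr] at h2
        change ‖p.1‖ ≤ ‖lam (n i)‖ * (r + 2 * η) + (ρ + 1)
        linarith
    · -- The separating line is orthogonal to the direction of `lam (n i) * a₀`.
      have hc0 : ‖lam (n i) * a₀‖ ≠ 0 := norm_ne_zero_iff.2 (mul_ne_zero (hne _) ha₀)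
      have hu : ‖(starRingEnd ℂ) (lam (n i) * a₀) / ‖lam (n i) * a₀‖‖ = 1 := by
        rw [norm_div, Complex.norm_conj, Complex.norm_real, norm_norm, div_self hc0]
      refine ⟨_, hu, ‖lam (n i)‖ * (r - 2 * η) - (ρ + 1), ?_, fun p hp => ?_⟩
      · rcases i with _ | i
        · change R < L * (r - 2 * η) - (ρ + 1)
          nlinarith
        · change ‖lam (n i)‖ * (r + 2 * η) + (ρ + 1) < ‖lam (n (i + 1))‖ * (r - 2 * η) - (ρ + 1)
          have h1 : ‖lam (n i)‖ * (r + 4 * η) ≤ ‖lam (n (i + 1))‖ * (r - 2 * η) :=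
            calc ‖lam (n i)‖ * (r + 4 * η) ≤ ‖lam (n i)‖ * ((1 + θ) * (r - 2 * η)) := by gcongr
              _ = (1 + θ) * ‖lam (n i)‖ * (r - 2 * η) := by ring
              _ ≤ _ := mul_le_mul_of_nonneg_right (hn i).1 (by linarith)
          nlinarith [mul_le_mul_of_nonneg_right (hLn i) hη0.le]
      · have h1 := norm_sub_le_of_mem_levelData hp
        set u := (starRingEnd ℂ) (lam (n i) * a₀) / ‖lam (n i) * a₀‖
        have h2 : u * (lam (n i) * a₀) = ((‖lam (n i)‖ * r : ℝ) : ℂ) := by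
          rw [hr, ← norm_mul, div_mul_eq_mul_div, mul_comm ((starRingEnd ℂ) _), Complex.mul_conj,
            Complex.normSq_eq_norm_sq, div_eq_iff (by exact_mod_cast hc0)]
          push_cast
          ring
        have h3 : u * p.1 = u * (p.1 - lam (n i) * a₀) + ((‖lam (n i)‖ * r : ℝ) : ℂ) := by
          rw [← h2]
          ring
        have h4 : |(u * (p.1 - lam (n i) * a₀)).re| ≤ ‖p.1 - lam (n i) * a₀‖ := by
          refine (Complex.abs_re_le_norm _).trans ?_
          rw [norm_mul, hu, one_mul]
        rw [h3, Complex.add_re, Complex.ofReal_re]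
        linarith [(abs_le.1 h4).1]
  obtain ⟨f, hf, hfG⟩ := happ (min ε' (ε / 2)) (by positivity)
  refine ⟨f, hf, fun z hz => ?_, fun a ha => ?_⟩
  · refine (hfG (z, f₀ z) ?_).trans_le (min_le_left _ _)
    exact Set.mem_iUnion₂.2 ⟨0, Nat.zero_le _, by simpa [discData] using hz⟩
  · set x : ℤ := round ((a - a₀).re / s)
    set y : ℤ := round ((a - a₀).im / s)
    obtain ⟨i, hi, hix, hiy⟩ := exists_residue_index hq0 x y
    set w : ℂ := s * (x + y * Complex.I) with hw
    have hround : ∀ b : ℝ, |b - s * round (b / s)| ≤ s / 2 := by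
      intro b
      have h1 := abs_sub_round (b / s)
      rw [show b - s * round (b / s) = s * (b / s - round (b / s)) by field_simp, abs_mul,
        abs_of_pos hs0]
      nlinarith
    have hdist : ‖a - a₀ - w‖ ≤ s := by
      refine (Complex.norm_le_abs_re_add_abs_im _).trans ?_
      have h1 := hround (a - a₀).re
      have h2 := hround (a - a₀).im
      have e1 : (a - a₀ - w).re = (a - a₀).re - s * x := by simp [hw]
      have e2 : (a - a₀ - w).im = (a - a₀).im - s * y := by simp [hw]
      rw [e1, e2]
      linarith
    have hwη : ‖w‖ ≤ 2 * η := by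
      have : ‖w‖ ≤ ‖a - a₀‖ + ‖a - a₀ - w‖ := by
        simpa using norm_sub_le (a - a₀) (a - a₀ - w)
      linarith
    refine ⟨n i, fun z hz => ?_⟩
    have hZ : z + lam (n i) * a - lam (n i) * (a₀ + w) - z = lam (n i) * (a - a₀ - w) := by ring
    have hZ' : ‖z + lam (n i) * a - lam (n i) * (a₀ + w) - z‖ ≤ δ := by
      rw [hZ, norm_mul, ← hsL, mul_comm s]
      exact mul_le_mul (hnL i hi) hdist (norm_nonneg _) (by positivity)
    have h1 := hδ z _ hz hZ'
    have hmem : (z + lam (n i) * a, g (z + lam (n i) * a - lam (n i) * (a₀ + w))) ∈ lvl i := by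
      refine ⟨x, y, hix, hiy, hwη, ?_, rfl⟩
      have : ‖z + lam (n i) * a - lam (n i) * (a₀ + w)‖ ≤
          ‖z + lam (n i) * a - lam (n i) * (a₀ + w) - z‖ + ‖z‖ := by
        simpa using norm_add_le (z + lam (n i) * a - lam (n i) * (a₀ + w) - z) z
      exact this.trans (by linarith)
    have h2 := (hfG _ (Set.mem_iUnion₂.2 ⟨i + 1, hi, hmem⟩)).trans_le (min_le_right _ _)
    calc ‖f (z + lam (n i) * a) - g z‖
        = ‖(f (z + lam (n i) * a) - g (z + lam (n i) * a - lam (n i) * (a₀ + w))) +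
          (g (z + lam (n i) * a - lam (n i) * (a₀ + w)) - g z)‖ := by ring_nf
      _ ≤ _ := norm_add_le _ _
      _ < ε := by linarith

/-! ### Category argument -/

/-- Density is first obtained near a single point: the size of the neighbourhood depends on `V`. -/
lemma exists_nhds_dense_hitSet {lam : ℕ+ → ℂ} (hne : ∀ n, lam n ≠ 0)
    (hinf : Tendsto (fun n => ‖lam n‖) atTop atTop)
    (hratio : Tendsto (fun n => lam (n + 1) / lam n) atTop (𝓝 1)) {a₀ : ℂ} (ha₀ : a₀ ≠ 0)
    {V : Set EntireFun} (hV : IsOpen V) (hVne : V.Nonempty) :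
    ∃ η > 0, Dense (hitSet lam (Metric.closedBall a₀ η) V) := by
  obtain ⟨g, hg⟩ := hVne
  obtain ⟨ρ, hρ, ε, hε, hgV⟩ := exists_disc_of_mem_open hV hg
  obtain ⟨η, hη, hhit⟩ := exists_entire_hitting hne hinf hratio ha₀ g.2 hρ hε
  refine ⟨η, hη, dense_iff_inter_open.2 ?_⟩
  rintro W hW ⟨f₀, hf₀⟩
  obtain ⟨R, hR, ε', hε', hf₀W⟩ := exists_disc_of_mem_open hW hf₀
  obtain ⟨f, hf, hff₀, hfg⟩ := hhit _ f₀.2 R hR ε' hε'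
  refine ⟨⟨⟨f, hf.continuous⟩, hf⟩, hf₀W _ hff₀, fun a ha => ?_⟩
  obtain ⟨n, hn⟩ := hfg a (by rwa [← dist_eq_norm])
  exact ⟨n, hgV _ hn⟩

lemma dense_hitSet {lam : ℕ+ → ℂ} (hne : ∀ n, lam n ≠ 0)
    (hinf : Tendsto (fun n => ‖lam n‖) atTop atTop)
    (hratio : Tendsto (fun n => lam (n + 1) / lam n) atTop (𝓝 1)) {K : Set ℂ} (hK : IsCompact K)
    (hK0 : 0 ∉ K) {V : Set EntireFun} (hV : IsOpen V) (hVne : V.Nonempty) :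
    Dense (hitSet lam K V) := by
  suffices h : ∃ O ⊆ hitSet lam K V, IsOpen O ∧ Dense O by
    obtain ⟨O, hO, -, hd⟩ := h
    exact hd.mono hO
  refine hK.induction_on (p := fun S => ∃ O ⊆ hitSet lam S V, IsOpen O ∧ Dense O) ?_ ?_ ?_ ?_
  · exact ⟨Set.univ, fun _ _ _ ha => ha.elim, isOpen_univ, dense_univ⟩
  · rintro S T hST ⟨O, hO, ho, hd⟩
    exact ⟨O, fun f hf a ha => hO hf a (hST ha), ho, hd⟩
  · rintro S T ⟨O, hO, ho, hd⟩ ⟨O', hO', ho', hd'⟩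
    exact ⟨O ∩ O', fun f hf a ha => ha.elim (hO hf.1 a) (hO' hf.2 a), ho.inter ho',
      hd.inter_of_isOpen_left hd' ho⟩
  · intro a ha
    obtain ⟨η, hη, hd⟩ := exists_nhds_dense_hitSet hne hinf hratio
      (ne_of_mem_of_not_mem ha hK0) hV hVne
    exact ⟨_, nhdsWithin_le_nhds (Metric.closedBall_mem_nhds a hη), _, subset_rfl,
      isOpen_hitSet lam (isCompact_closedBall a η) hV, hd⟩

/-- The punctured plane is a countable union of compact sets. -/
lemma exists_compact_exhaustion_punctured_plane :
    ∃ K : ℕ → Set ℂ, (∀ m, IsCompact (K m)) ∧ (∀ m, 0 ∉ K m) ∧ ∀ a ≠ 0, ∃ m, a ∈ K m := by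
  refine ⟨fun m => Metric.closedBall 0 m ∩ (Metric.ball 0 (1 / (m + 1)))ᶜ,
    fun m => (isCompact_closedBall _ _).inter_right Metric.isOpen_ball.isClosed_compl,
    fun m hm => hm.2 (Metric.mem_ball_self (by positivity)), fun a ha => ?_⟩
  obtain ⟨m₁, h₁⟩ := exists_nat_ge ‖a‖
  obtain ⟨m₂, h₂⟩ := exists_nat_one_div_lt (norm_pos_iff.2 ha)
  refine ⟨max m₁ m₂, ?_, ?_⟩
  · rw [mem_closedBall_zero_iff]
    exact h₁.trans (by exact_mod_cast le_max_left _ _)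
  · rw [Set.mem_compl_iff, mem_ball_zero_iff, not_lt]
    refine le_trans (one_div_le_one_div_of_le (by positivity) ?_) h₂.le
    gcongr
    exact le_max_right _ _

theorem theorem2 (lam : ℕ+ → ℂ) (hne : ∀ n, lam n ≠ 0)
    (h1 : Tendsto (fun n => ‖lam (n + 1)‖ - ‖lam n‖) atTop atTop)
    (h2 : Tendsto (fun n => lam (n + 1) / lam n) atTop (𝓝 1))
    (h3 : (0 : EReal) <
      liminf (fun n : ℕ+ => (((n : ℝ) * (‖lam (n + 1) / lam n‖ - 1) : ℝ) : EReal)) atTop) :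
    IsGδ (⋂ a ∈ {a : ℂ | a ≠ 0}, HC fun n => translation (lam n * a)) ∧
      Dense (⋂ a ∈ {a : ℂ | a ≠ 0}, HC fun n => translation (lam n * a)) := by
  have hinf := tendsto_norm_atTop_of_sub h1
  obtain ⟨K, hK, hK0, hKa⟩ := exists_compact_exhaustion_punctured_plane
  have : SecondCountableTopology EntireFun := TopologicalSpace.Subtype.secondCountableTopology _
  obtain ⟨b, hbc, hb0, hb⟩ := TopologicalSpace.exists_countable_basis EntireFun
  have : Countable b := hbc
  have hbne : ∀ V ∈ b, V.Nonempty := fun V hV =>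
    Set.nonempty_iff_ne_empty.2 fun h => hb0 (h ▸ hV)
  have heq : (⋂ a ∈ {a : ℂ | a ≠ 0}, HC fun n => translation (lam n * a)) =
      ⋂ i : ℕ × b, hitSet lam (K i.1) i.2 := by
    ext f
    simp only [Set.mem_iInter]
    constructor
    · rintro hf ⟨m, V, hV⟩ a ha
      obtain ⟨-, hx, n, rfl⟩ := (hf a (ne_of_mem_of_not_mem ha (hK0 m))).inter_open_nonempty V
        (hb.isOpen hV) (hbne V hV)
      exact ⟨n, hx⟩
    · intro hf a ha
      obtain ⟨m, hm⟩ := hKa a ha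
      refine hb.dense_iff.2 fun V hV _ => ?_
      obtain ⟨n, hn⟩ := hf (m, ⟨V, hV⟩) a hm
      exact ⟨_, hn, n, rfl⟩
  have hopen : ∀ i : ℕ × b, IsOpen (hitSet lam (K i.1) i.2) := fun i =>
    isOpen_hitSet lam (hK _) (hb.isOpen i.2.2)
  rw [heq]
  exact ⟨.iInter_of_isOpen hopen, dense_iInter_of_isOpen hopen fun i =>
    dense_hitSet hne hinf h2 (hK _) (hK0 _) (hb.isOpen i.2.2) (hbne _ i.2.2)⟩
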